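/- Let $\mathbb{D}$ be the open unit disk and, for $0<p<\infty$, let $H^p$ be the space of holomorphic functions $f$ on $\mathbb{D}$ with $\|f\|_p:=\Big(\sup_{0<r<1}\frac1{2\pi}\int_0^{2\pi}|f(re^{i\theta})|^p\,d\theta\Big)^{1/p}<\infty$. For $s\in\mathbb{C}$ with $\mathrm{Re}(s)>0$ put $$f_0(s)=-\frac1s,\qquad f_n(s)=-\frac1s\big((n+1)^{1-s}-n^{1-s}\big)\quad(n\ge1),$$ and let $\Lambda^{(s)}$ be the linear functional given by $z^n\mapsto f_n(s)$ $(n\ge 0)$, that is, $\Lambda^{(s)}\big(\sum_{n\ge0}a_nz^n\big)=\sum_{n\ge0}a_nf_n(s)$. We say that $\Lambda^{(s)}$ is bounded on $H^p$ if the series $\sum_{n\ge0} a_nf_n(s)$ converges absolutely for every $f=\sum_{n\ge0} a_nz^n\in H^p$ and there is a constant $C$ (depending on $p$ and $s$ only) with $|\Lambda^{(s)}f|\le C\|f\|_p$ for all $f\in H^p$. **Proposition.** If $1\le p\le 2$, then $\Lambda^{(s)}$ is bounded on $H^p$ for every $s\in\mathbb{C}$ with $\mathrm{Re}(s)>1/p$.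 In addition, $\Lambda^{(s)}$ is bounded on $H^1$ for every $s\in\mathbb{C}$ with $\mathrm{Re}(s)\ge1$. -/

import Mathlib

open scoped ENNReal

noncomputable section

/-- The quantity `‖f‖_p ^ p`, that is, the supremum over `0 < r < 1` of the mean of
`|f (r z)| ^ p` over the unit circle with respect to normalized Lebesgue measure. -/
def hardyMean (p : ℝ) (f : ℂ → ℂ) : ℝ≥0∞ :=
  ⨆ r ∈ Set.Ioo (0 : ℝ) 1, ENNReal.ofReal (1 / (2 * Real.pi)) *
    ∫⁻ θ in Set.Ioc (0 : ℝ) (2 * Real.pi),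
      ‖f ((r : ℂ) * Complex.exp ((θ : ℂ) * Complex.I))‖ₑ ^ p

theorem hardyMean_add_lt_top {p : ℝ} (hp : 0 < p) {f g : ℂ → ℂ}
    (hf : ContinuousOn f (Metric.ball 0 1))
    (h1 : hardyMean p f < ∞) (h2 : hardyMean p g < ∞) : hardyMean p (f + g) < ∞ := by
  have key : hardyMean p (f + g) ≤ (2 : ℝ≥0∞) ^ p * (hardyMean p f + hardyMean p g) := by
    refine iSup₂_le fun r hr => ?_
    have hF := le_iSup₂ (f := fun (r : ℝ) (_ : r ∈ Set.Ioo (0 : ℝ) 1) =>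
      ENNReal.ofReal (1 / (2 * Real.pi)) * ∫⁻ θ in Set.Ioc (0 : ℝ) (2 * Real.pi),
      ‖f ((r : ℂ) * Complex.exp ((θ : ℂ) * Complex.I))‖ₑ ^ p) r hr
    have hG := le_iSup₂ (f := fun (r : ℝ) (_ : r ∈ Set.Ioo (0 : ℝ) 1) =>
      ENNReal.ofReal (1 / (2 * Real.pi)) * ∫⁻ θ in Set.Ioc (0 : ℝ) (2 * Real.pi),
      ‖g ((r : ℂ) * Complex.exp ((θ : ℂ) * Complex.I))‖ₑ ^ p) r hr
    have hpt : ∀ a b : ℂ, ‖a + b‖ₑ ^ p ≤ (2 : ℝ≥0∞) ^ p * (‖a‖ₑ ^ p + ‖b‖ₑ ^ p) := by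
      intro a b
      rcases le_total ‖a‖ₑ ‖b‖ₑ with h | h
      · calc ‖a + b‖ₑ ^ p ≤ (2 * ‖b‖ₑ) ^ p := by
              refine ENNReal.rpow_le_rpow ((enorm_add_le a b).trans ?_) hp.le
              rw [two_mul]; gcongr
          _ = (2 : ℝ≥0∞) ^ p * ‖b‖ₑ ^ p := ENNReal.mul_rpow_of_nonneg _ _ hp.le
          _ ≤ _ := by gcongr; exact le_add_self
      · calc ‖a + b‖ₑ ^ p ≤ (2 * ‖a‖ₑ) ^ p := by
              refine ENNReal.rpow_le_rpow ((enorm_add_le a b).trans ?_) hp.le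
              rw [two_mul]; gcongr
          _ = (2 : ℝ≥0∞) ^ p * ‖a‖ₑ ^ p := ENNReal.mul_rpow_of_nonneg _ _ hp.le
          _ ≤ _ := by gcongr; exact le_self_add
    have hcont : Continuous fun θ : ℝ => f ((r : ℂ) * Complex.exp ((θ : ℂ) * Complex.I)) := by
      refine hf.comp_continuous (by fun_prop) fun θ => ?_
      simp only [Metric.mem_ball, dist_zero_right, norm_mul, Complex.norm_real,
        Complex.norm_exp_ofReal_mul_I, mul_one, Real.norm_eq_abs, abs_of_pos hr.1]
      exact hr.2
    have hmeas : Measurable fun θ : ℝ =>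
        ‖f ((r : ℂ) * Complex.exp ((θ : ℂ) * Complex.I))‖ₑ ^ p :=
      hcont.measurable.enorm.pow_const p
    calc _ ≤ ENNReal.ofReal (1 / (2 * Real.pi)) *
          ∫⁻ θ in Set.Ioc (0 : ℝ) (2 * Real.pi), (2 : ℝ≥0∞) ^ p *
            (‖f ((r : ℂ) * Complex.exp ((θ : ℂ) * Complex.I))‖ₑ ^ p +
              ‖g ((r : ℂ) * Complex.exp ((θ : ℂ) * Complex.I))‖ₑ ^ p) := by
            gcongr
            exact hpt _ _
      _ = (2 : ℝ≥0∞) ^ p * (ENNReal.ofReal (1 / (2 * Real.pi)) *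
            (∫⁻ θ in Set.Ioc (0 : ℝ) (2 * Real.pi),
              ‖f ((r : ℂ) * Complex.exp ((θ : ℂ) * Complex.I))‖ₑ ^ p) +
            ENNReal.ofReal (1 / (2 * Real.pi)) *
            ∫⁻ θ in Set.Ioc (0 : ℝ) (2 * Real.pi),
              ‖g ((r : ℂ) * Complex.exp ((θ : ℂ) * Complex.I))‖ₑ ^ p) := by
            rw [MeasureTheory.lintegral_const_mul' _ _
              (ENNReal.rpow_ne_top_of_nonneg hp.le (by simp)),
              MeasureTheory.lintegral_add_left hmeas]
            ring
      _ ≤ _ := by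
            gcongr
            · exact hF
            · exact hG
  refine key.trans_lt (ENNReal.mul_lt_top ?_ (ENNReal.add_lt_top.2 ⟨h1, h2⟩))
  exact ENNReal.rpow_lt_top_of_nonneg hp.le (by simp)

theorem hardyMean_smul {p : ℝ} (hp : 0 < p) (c : ℂ) (f : ℂ → ℂ) :
    hardyMean p (c • f) = ‖c‖ₑ ^ p * hardyMean p f := by
  simp only [hardyMean, ENNReal.mul_iSup]
  refine iSup_congr fun r => iSup_congr fun _ => ?_
  simp only [Pi.smul_apply, enorm_smul, ENNReal.mul_rpow_of_nonneg _ _ hp.le]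
  rw [MeasureTheory.lintegral_const_mul' _ _
    (ENNReal.rpow_ne_top_of_nonneg hp.le (by simp))]
  ring

/-- The Hardy space `H^p` (`0 < p < ∞`) of the open unit disk. A function on the disk is
represented by its extension by `0` to the whole plane, so that elements are determined by their
values on the disk. -/
def hardySpace (p : ℝ) (hp : 0 < p) : Submodule ℂ (ℂ → ℂ) where
  carrier := {f | DifferentiableOn ℂ f (Metric.ball 0 1) ∧
    (∀ z ∉ Metric.ball (0 : ℂ) 1, f z = 0) ∧ hardyMean p f < ∞}
  zero_mem' := by
    refine ⟨differentiableOn_const 0, fun _ _ => rfl, ?_⟩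
    simp [hardyMean, hp]
  add_mem' := by
    rintro f g ⟨hf, hf0, hfm⟩ ⟨hg, hg0, hgm⟩
    exact ⟨hf.add hg, fun z hz => by simp [hf0 z hz, hg0 z hz],
      hardyMean_add_lt_top hp hf.continuousOn hfm hgm⟩
  smul_mem' := by
    rintro c f ⟨hf, hf0, hfm⟩
    refine ⟨hf.const_smul c, fun z hz => by simp [hf0 z hz], ?_⟩
    rw [hardyMean_smul hp]
    exact ENNReal.mul_lt_top (ENNReal.rpow_lt_top_of_nonneg hp.le (by simp)) hfm

/-- The norm `‖f‖_p` (a quasi-norm if `p < 1`). It is finite on `H^p`. -/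
def hardyNorm (p : ℝ) (f : ℂ → ℂ) : ℝ :=
  (hardyMean p f).toReal ^ (1 / p)

/-- The monomial `z ^ n` as an element of `H^p`. -/
def hardyMonomial (p : ℝ) (hp : 0 < p) (n : ℕ) : hardySpace p hp :=
  ⟨(Metric.ball (0 : ℂ) 1).indicator fun z => z ^ n, by
    refine ⟨?_, fun z hz => Set.indicator_of_notMem hz _, ?_⟩
    · exact (differentiableOn_id.pow n).congr fun z hz => Set.indicator_of_mem hz _
    · refine lt_of_le_of_lt (iSup₂_le fun r hr => ?_)
        (b := ENNReal.ofReal (1 / (2 * Real.pi)) *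
          ∫⁻ _ in Set.Ioc (0 : ℝ) (2 * Real.pi), 1) ?_
      · gcongr with θ
        refine ENNReal.rpow_le_one ?_ hp.le
        refine (enorm_indicator_le_enorm_self _ _).trans ?_
        rw [← ofReal_norm, ENNReal.ofReal_le_one]
        simp only [norm_pow, norm_mul, Complex.norm_real, Complex.norm_exp_ofReal_mul_I,
          mul_one, Real.norm_eq_abs, abs_of_pos hr.1]
        exact pow_le_one₀ hr.1.le hr.2.le
      · simp [ENNReal.mul_lt_top_iff]⟩

/-- The `n`-th Taylor coefficient at the origin. -/
def taylorCoeffZero (f : ℂ → ℂ) (n : ℕ) : ℂ :=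
  iteratedDeriv n f 0 / (n.factorial : ℂ)

/-- The values `f_n(s)`: `f_0(s) = -1/s`, and
`f_n(s) = -(1/s) ((n+1)^(1-s) - n^(1-s))` for `n ≥ 1`. -/
def lambdaValue (n : ℕ) (s : ℂ) : ℂ :=
  if n = 0 then -(1 / s)
  else -(1 / s) * (((n : ℂ) + 1) ^ (1 - s) - (n : ℂ) ^ (1 - s))

/-- The functional `Λ^(s)`, determined by `z ^ n ↦ f_n(s)`, is (well defined and) bounded on
`H^p`: there is a bounded linear functional on `H^p` that sends `z ^ n` to `f_n(s)` for all `n`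
and, more generally, `∑ a_n z ^ n` to the convergent sum `∑ a_n f_n(s)`. -/
def LambdaBoundedOn (p : ℝ) (hp : 0 < p) (s : ℂ) : Prop :=
  ∃ Λ : hardySpace p hp →ₗ[ℂ] ℂ,
    (∀ n : ℕ, Λ (hardyMonomial p hp n) = lambdaValue n s) ∧
    (∀ f : hardySpace p hp,
      HasSum (fun n : ℕ => taylorCoeffZero (f : ℂ → ℂ) n * lambdaValue n s) (Λ f)) ∧
    ∃ C : ℝ, ∀ f : hardySpace p hp, ‖Λ f‖ ≤ C * hardyNorm p (f : ℂ → ℂ)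

end

/-!
The mean value inequality gives `f_n(s) = O((n + 1) ^ (-Re s))`, so everything reduces to bounding
`∑ |a_n| (n + 1) ^ (-Re s)` by a multiple of `‖f‖_p`, uniformly over the partial sums
(`lambdaBoundedOn_of_sum_le`). Such a bound on finitely many coefficients has to be proved for
polynomials only, with the mean over the unit circle in place of the Hardy norm
(`sum_mul_norm_taylorCoeffZero_le_hardyNorm`).

For `1 < p ≤ 2` one has `∑_{n < N} |a_n| ≤ N ^ (1 / p) ‖f‖_p`. This follows by pairing `f` with the
polynomial `g` of degree `< N` whose coefficients are the phases of the `a_n`: as `|g| ≤ N` and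
`∫ |g| ^ 2 ≤ N`, the norm of `g` in `L ^ q`, with `q ≥ 2` the conjugate exponent, is at most
`N ^ (1 - 1 / q) = N ^ (1 / p)` (`DiffContOnCl.sum_norm_taylorCoeffZero_le`). Because
`Re s > 1 / p` strictly, summing over dyadic blocks costs only a geometric series
(`exists_sum_rpow_neg_le`), and the full Hausdorff–Young inequality is not needed.

For `p = 1` and `Re s ≥ 1` the bound is Hardy's inequality `∑ |a_n| / (n + 1) ≤ C ‖f‖_1`. A
polynomial `P` factors as `g h` on the disk with `|g| ^ 2 = |h| ^ 2 = |P|` on the circle: each linear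
factor of `P` is either a Blaschke factor times a zero-free function, or already zero-free in the
disk, and square roots of zero-free linear functions are explicit (`Polynomial.exists_factor`).
The coefficients of `P` are the convolution of those of `g` and `h`, whose square sums are bounded by
the mean of `|P|`, and Hilbert's inequality (`sum_mul_div_hilbert_le`) finishes the proof
(`Polynomial.sum_norm_taylorCoeffZero_div_le`).
-/

open MeasureTheory Metric Filter Topology
open scoped ComplexConjugate Real

/-! ### Fourier coefficients on the unit circle -/

/-- Normalized Lebesgue measure on the unit circle, as a measure in the angle
`θ ∈ (0, 2π]`. -/
noncomputable def circleProb : Measure ℝ :=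
  ENNReal.ofReal (1 / (2 * π)) • volume.restrict (Set.Ioc (0 : ℝ) (2 * π))

instance : IsProbabilityMeasure circleProb := by
  constructor
  rw [circleProb, Measure.smul_apply, Measure.restrict_apply_univ, Real.volume_Ioc, sub_zero,
    smul_eq_mul, ← ENNReal.ofReal_mul (by positivity), one_div,
    inv_mul_cancel₀ (by positivity), ENNReal.ofReal_one]

theorem Continuous.memLp_circleProb {E : Type*} [NormedAddCommGroup E]
    [SecondCountableTopologyEither ℝ E] {g : ℝ → E} (hg : Continuous g) (q : ℝ≥0∞) :
    MemLp g q circleProb := by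
  obtain ⟨C, hC⟩ := (isCompact_Icc (a := (0 : ℝ)) (b := 2 * π)).exists_bound_of_continuousOn
    hg.continuousOn
  refine MemLp.of_bound hg.aestronglyMeasurable C ?_
  refine Measure.ae_smul_measure ?_ _
  exact ae_restrict_of_forall_mem measurableSet_Ioc fun x hx => hC x ⟨hx.1.le, hx.2⟩

theorem Continuous.integrable_circleProb {E : Type*} [NormedAddCommGroup E]
    [SecondCountableTopologyEither ℝ E] {g : ℝ → E} (hg : Continuous g) :
    Integrable g circleProb :=
  memLp_one_iff_integrable.1 (hg.memLp_circleProb 1)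

theorem DiffContOnCl.continuous_circleMap {f : ℂ → ℂ} (hf : DiffContOnCl ℂ f (ball 0 1)) :
    Continuous fun θ : ℝ => f (circleMap 0 1 θ) :=
  hf.continuousOn_ball.comp_continuous (_root_.continuous_circleMap 0 1) fun θ =>
    circleMap_mem_closedBall 0 zero_le_one θ

/-- The Taylor coefficients of a function that is continuous up to the boundary are the
Fourier coefficients of its boundary values. -/
theorem DiffContOnCl.integral_mul_conj_pow {f : ℂ → ℂ} (hf : DiffContOnCl ℂ f (ball 0 1))
    (n : ℕ) :
    ∫ θ, f (circleMap 0 1 θ) * conj (circleMap 0 1 θ) ^ n ∂circleProb = taylorCoeffZero f n := by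
  have h := hf.circleIntegral_one_div_sub_center_pow_smul one_pos n
  rw [circleIntegral, intervalIntegral.integral_of_le (by positivity)] at h
  have hpt : ∀ θ : ℝ, deriv (circleMap 0 1) θ • (1 / (circleMap 0 1 θ - 0) ^ (n + 1)) •
      f (circleMap 0 1 θ) = Complex.I * (f (circleMap 0 1 θ) * conj (circleMap 0 1 θ) ^ n) := by
    intro θ
    have h0 : circleMap 0 1 θ ≠ 0 := circleMap_ne_center one_ne_zero
    have h1 : conj (circleMap 0 1 θ) = (circleMap 0 1 θ)⁻¹ := by
      rw [Complex.inv_def, Complex.normSq_eq_norm_sq]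
      simp
    rw [deriv_circleMap, h1, inv_pow, pow_succ]
    simp only [sub_zero, smul_eq_mul]
    field_simp
  simp_rw [hpt] at h
  rw [integral_const_mul] at h
  rw [circleProb, integral_smul_measure, ENNReal.toReal_ofReal (by positivity), taylorCoeffZero,
    Complex.real_smul]
  have hI := Complex.I_ne_zero
  have hpi : (π : ℂ) ≠ 0 := by exact_mod_cast Real.pi_ne_zero
  have hfac : (n.factorial : ℂ) ≠ 0 := by exact_mod_cast n.factorial_ne_zero
  rw [smul_eq_mul] at h
  push_cast
  field_simp at h ⊢
  linear_combination h

theorem taylorCoeffZero_sum_pow (N : ℕ) (s : ℕ → ℂ) (n : ℕ) :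
    taylorCoeffZero (fun z => ∑ k ∈ Finset.range N, s k * z ^ k) n =
      if n < N then s n else 0 := by
  have hfac : (n.factorial : ℂ) ≠ 0 := by exact_mod_cast n.factorial_ne_zero
  rw [taylorCoeffZero, iteratedDeriv_fun_sum fun i _ => by fun_prop]
  have : ∀ k, iteratedDeriv n (fun z : ℂ => s k * z ^ k) 0 =
      if n = k then s k * (k.factorial : ℂ) else 0 := by
    intro k
    rw [iteratedDeriv_const_mul_field, iteratedDeriv_fun_pow_zero]
    split_ifs <;> simp
  simp_rw [this]
  rw [Finset.sum_ite_eq]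
  simp only [Finset.mem_range]
  split_ifs
  · field_simp
  · simp

theorem DiffContOnCl.integral_mul_conj_sum {f : ℂ → ℂ} (hf : DiffContOnCl ℂ f (ball 0 1))
    (N : ℕ) (s : ℕ → ℂ) :
    ∫ θ, f (circleMap 0 1 θ) * conj (∑ n ∈ Finset.range N, s n * circleMap 0 1 θ ^ n)
      ∂circleProb = ∑ n ∈ Finset.range N, conj (s n) * taylorCoeffZero f n := by
  have hc := hf.continuous_circleMap
  have hm := _root_.continuous_circleMap 0 1
  have hpt : ∀ θ, f (circleMap 0 1 θ) * conj (∑ n ∈ Finset.range N, s n * circleMap 0 1 θ ^ n) =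
      ∑ n ∈ Finset.range N, conj (s n) * (f (circleMap 0 1 θ) * conj (circleMap 0 1 θ) ^ n) := by
    intro θ
    rw [map_sum, Finset.mul_sum]
    refine Finset.sum_congr rfl fun n _ => ?_
    rw [map_mul, map_pow]
    ring
  simp_rw [hpt]
  rw [integral_finsetSum]
  · refine Finset.sum_congr rfl fun n _ => ?_
    rw [integral_const_mul, hf.integral_mul_conj_pow]
  · intro n _
    refine Continuous.integrable_circleProb ?_
    exact continuous_const.mul (hc.mul ((Complex.continuous_conj.comp hm).pow n))

/-- Parseval's identity for polynomials. -/
theorem integral_norm_sq_sum_pow (N : ℕ) (s : ℕ → ℂ) :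
    ∫ θ, ‖∑ n ∈ Finset.range N, s n * circleMap 0 1 θ ^ n‖ ^ 2 ∂circleProb =
      ∑ n ∈ Finset.range N, ‖s n‖ ^ 2 := by
  have hS : DiffContOnCl ℂ (fun z => ∑ n ∈ Finset.range N, s n * z ^ n) (ball 0 1) :=
    Differentiable.diffContOnCl (by fun_prop)
  have h := hS.integral_mul_conj_sum N s
  have h2 : ∑ n ∈ Finset.range N, conj (s n) *
      taylorCoeffZero (fun z => ∑ n ∈ Finset.range N, s n * z ^ n) n =
      ((∑ n ∈ Finset.range N, ‖s n‖ ^ 2 : ℝ) : ℂ) := by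
    push_cast
    refine Finset.sum_congr rfl fun n hn => ?_
    rw [taylorCoeffZero_sum_pow, if_pos (Finset.mem_range.1 hn), Complex.conj_mul']
  rw [h2] at h
  simp only [Complex.mul_conj'] at h
  exact_mod_cast h

/-- Bessel's inequality for the Taylor coefficients. -/
theorem DiffContOnCl.sum_norm_sq_taylorCoeffZero_le {f : ℂ → ℂ}
    (hf : DiffContOnCl ℂ f (ball 0 1)) (N : ℕ) :
    ∑ n ∈ Finset.range N, ‖taylorCoeffZero f n‖ ^ 2 ≤
      ∫ θ, ‖f (circleMap 0 1 θ)‖ ^ 2 ∂circleProb := by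
  set S : ℝ → ℂ := fun θ => ∑ n ∈ Finset.range N, taylorCoeffZero f n * circleMap 0 1 θ ^ n
    with hS
  have hc := hf.continuous_circleMap
  have hm := _root_.continuous_circleMap 0 1
  have hSc : Continuous S := by fun_prop
  have hcross : ∫ θ, (f (circleMap 0 1 θ) * conj (S θ)).re ∂circleProb =
      ∑ n ∈ Finset.range N, ‖taylorCoeffZero f n‖ ^ 2 := by
    have hi : Integrable (fun θ => f (circleMap 0 1 θ) * conj (S θ)) circleProb :=
      (hc.mul (Complex.continuous_conj.comp hSc)).integrable_circleProb
    have := Complex.reCLM.integral_comp_comm hi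
    simp only [Complex.reCLM_apply] at this
    rw [this, hf.integral_mul_conj_sum N (taylorCoeffZero f)]
    simp only [Complex.conj_mul']
    exact_mod_cast Complex.ofReal_re _
  have hpt : ∀ θ, ‖f (circleMap 0 1 θ) - S θ‖ ^ 2 = ‖f (circleMap 0 1 θ)‖ ^ 2 + ‖S θ‖ ^ 2 -
      2 * (f (circleMap 0 1 θ) * conj (S θ)).re := fun θ => by
    simp only [Complex.sq_norm, Complex.normSq_sub]
  -- Expanding this nonnegative integral gives `∫ |f|² - ∑ |a_n|²`.
  have h0 : 0 ≤ ∫ θ, ‖f (circleMap 0 1 θ) - S θ‖ ^ 2 ∂circleProb :=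
    integral_nonneg fun θ => by positivity
  simp_rw [hpt] at h0
  rw [integral_sub, integral_add, integral_const_mul, hcross, integral_norm_sq_sum_pow] at h0
  · linarith
  · exact (hc.norm.pow 2).integrable_circleProb
  · exact (hSc.norm.pow 2).integrable_circleProb
  · exact ((hc.norm.pow 2).add (hSc.norm.pow 2)).integrable_circleProb
  · exact (continuous_const.mul (Complex.continuous_re.comp
      (hc.mul (Complex.continuous_conj.comp hSc)))).integrable_circleProb

/-! ### Sums of absolute values of coefficients for `1 < p ≤ 2` -/

/-- A substitute for the Hausdorff–Young inequality: pair `f` with the polynomial `g` whose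
coefficients are the phases of the first `N` coefficients of `f`. Hölder's inequality, together
with `|g| ≤ N` and `∫ |g| ^ 2 ≤ N`, gives the bound. -/
theorem DiffContOnCl.sum_norm_taylorCoeffZero_le {f : ℂ → ℂ}
    (hf : DiffContOnCl ℂ f (ball 0 1)) {p : ℝ} (hp1 : 1 < p) (hp2 : p ≤ 2) (N : ℕ) :
    ∑ n ∈ Finset.range N, ‖taylorCoeffZero f n‖ ≤
      (N : ℝ) ^ (1 / p) * (∫ θ, ‖f (circleMap 0 1 θ)‖ ^ p ∂circleProb) ^ (1 / p) := by
  rcases Nat.eq_zero_or_pos N with rfl | hN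
  · simp only [Finset.range_zero, Finset.sum_empty]
    have : 0 ≤ ∫ θ, ‖f (circleMap 0 1 θ)‖ ^ p ∂circleProb :=
      integral_nonneg fun θ => by positivity
    positivity
  have hN0 : (0 : ℝ) < N := by exact_mod_cast hN
  -- The phase of `a_n`, and `0` when `a_n = 0`.
  set e : ℕ → ℂ := fun n => taylorCoeffZero f n / ‖taylorCoeffZero f n‖ with he
  have he1 : ∀ n, ‖e n‖ ≤ 1 := by
    intro n
    simp only [he, norm_div, Complex.norm_real, norm_norm]
    exact div_self_le_one _
  have hea : ∀ n, conj (e n) * taylorCoeffZero f n = (‖taylorCoeffZero f n‖ : ℂ) := by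
    intro n
    simp only [he, map_div₀, Complex.conj_ofReal]
    rw [div_mul_eq_mul_div, Complex.conj_mul']
    rcases eq_or_ne ‖taylorCoeffZero f n‖ 0 with h | h
    · simp [h]
    · have : (‖taylorCoeffZero f n‖ : ℂ) ≠ 0 := by exact_mod_cast h
      field_simp
  set g : ℝ → ℂ := fun θ => ∑ n ∈ Finset.range N, e n * circleMap 0 1 θ ^ n with hg
  have hc := hf.continuous_circleMap
  have hm := _root_.continuous_circleMap 0 1
  have hgc : Continuous g := by fun_prop
  have hgN : ∀ θ, ‖g θ‖ ≤ N := by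
    intro θ
    refine (norm_sum_le _ _).trans ?_
    calc _ ≤ ∑ n ∈ Finset.range N, (1 : ℝ) := by
          refine Finset.sum_le_sum fun n _ => ?_
          simpa using he1 n
      _ = N := by simp
  set q := p.conjExponent with hq
  have hpq : p.HolderConjugate q := Real.HolderConjugate.conjExponent hp1
  have hq2 : 2 ≤ q := by
    rw [hq, Real.conjExponent, le_div_iff₀ (by linarith)]
    linarith
  have hg2 : ∫ θ, ‖g θ‖ ^ q ∂circleProb ≤ (N : ℝ) ^ (q - 1) := by
    have hle : ∀ θ, ‖g θ‖ ^ q ≤ (N : ℝ) ^ (q - 2) * ‖g θ‖ ^ 2 := by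
      intro θ
      calc ‖g θ‖ ^ q = ‖g θ‖ ^ (q - 2) * ‖g θ‖ ^ (2 : ℝ) := by
            rw [← Real.rpow_add_of_nonneg (norm_nonneg _) (by linarith) (by norm_num)]
            ring_nf
        _ ≤ _ := by
            rw [Real.rpow_two]
            gcongr
            exact hgN θ
    calc _ ≤ ∫ θ, (N : ℝ) ^ (q - 2) * ‖g θ‖ ^ 2 ∂circleProb := by
          refine integral_mono ?_ ?_ hle
          · exact (hgc.norm.rpow_const fun _ => Or.inr (by linarith)).integrable_circleProb
          · exact (continuous_const.mul (hgc.norm.pow 2)).integrable_circleProb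
      _ = (N : ℝ) ^ (q - 2) * ∑ n ∈ Finset.range N, ‖e n‖ ^ 2 := by
          rw [integral_const_mul, integral_norm_sq_sum_pow]
      _ ≤ (N : ℝ) ^ (q - 2) * ∑ n ∈ Finset.range N, 1 := by
          gcongr with n
          exact pow_le_one₀ (norm_nonneg _) (he1 n)
      _ = (N : ℝ) ^ (q - 2) * (N : ℝ) ^ (1 : ℝ) := by simp
      _ = _ := by rw [← Real.rpow_add hN0]; ring_nf
  have hqinv : (q - 1) * (1 / q) = 1 / p := by
    have h1 := hpq.inv_add_inv_eq_one
    have h2 := hpq.symm.ne_zero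
    rw [sub_mul, mul_one_div_cancel h2, one_mul, one_div, one_div]
    linarith
  have hsum : ((∑ n ∈ Finset.range N, ‖taylorCoeffZero f n‖ : ℝ) : ℂ) =
      ∫ θ, f (circleMap 0 1 θ) * conj (g θ) ∂circleProb := by
    rw [hf.integral_mul_conj_sum N e]
    simp [hea]
  calc _ = ‖((∑ n ∈ Finset.range N, ‖taylorCoeffZero f n‖ : ℝ) : ℂ)‖ := by
        rw [Complex.norm_real, Real.norm_of_nonneg (by positivity)]
    _ ≤ ∫ θ, ‖f (circleMap 0 1 θ)‖ * ‖g θ‖ ∂circleProb := by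
        rw [hsum]
        refine (norm_integral_le_integral_norm _).trans_eq ?_
        simp
    _ ≤ (∫ θ, ‖f (circleMap 0 1 θ)‖ ^ p ∂circleProb) ^ (1 / p) *
          (∫ θ, ‖g θ‖ ^ q ∂circleProb) ^ (1 / q) :=
        integral_mul_norm_le_Lp_mul_Lq hpq (hc.memLp_circleProb _) (hgc.memLp_circleProb _)
    _ ≤ (∫ θ, ‖f (circleMap 0 1 θ)‖ ^ p ∂circleProb) ^ (1 / p) *
          ((N : ℝ) ^ (q - 1)) ^ (1 / q) := by
        have h1 : 0 ≤ ∫ θ, ‖f (circleMap 0 1 θ)‖ ^ p ∂circleProb :=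
          integral_nonneg fun θ => by positivity
        have h2 : 0 ≤ ∫ θ, ‖g θ‖ ^ q ∂circleProb := integral_nonneg fun θ => by positivity
        have h3 := hpq.symm.pos
        gcongr
    _ = _ := by rw [← Real.rpow_mul hN0.le, hqinv, mul_comm]

/-- Summation over dyadic blocks: if `∑_{n < N} a n = O(N ^ t)` with `t < σ`, then
`∑ a n * (n + 1) ^ (-σ)` converges. -/
theorem exists_sum_rpow_neg_le {t σ : ℝ} (hσ : t < σ) (ht : 0 ≤ t) :
    ∃ C : ℝ, ∀ (a : ℕ → ℝ) (M : ℝ), (∀ n, 0 ≤ a n) → 0 ≤ M →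
      (∀ N : ℕ, ∑ n ∈ Finset.range N, a n ≤ (N : ℝ) ^ t * M) →
      ∀ N : ℕ, ∑ n ∈ Finset.range N, a n * ((n : ℝ) + 1) ^ (-σ) ≤ C * M := by
  set ρ : ℝ := 2 ^ (t - σ) with hρ
  have hρ0 : 0 < ρ := by positivity
  have hρ1 : ρ < 1 := Real.rpow_lt_one_of_one_lt_of_neg one_lt_two (by linarith)
  refine ⟨2 ^ t * (1 - ρ)⁻¹, fun a M ha hM h N => ?_⟩
  have hterm : ∀ n, 0 ≤ a n * ((n : ℝ) + 1) ^ (-σ) := fun n =>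
    mul_nonneg (ha n) (by positivity)
  -- The `k`-th block consists of the `n` with `2 ^ k ≤ n + 1 < 2 ^ (k + 1)`.
  have hblock : ∀ K : ℕ, ∑ n ∈ Finset.range (2 ^ K - 1), a n * ((n : ℝ) + 1) ^ (-σ) ≤
      2 ^ t * M * ∑ k ∈ Finset.range K, ρ ^ k := by
    intro K
    induction K with
    | zero => simp
    | succ K ih =>
      have hK : 2 ^ K - 1 ≤ 2 ^ (K + 1) - 1 :=
        Nat.sub_le_sub_right (Nat.pow_le_pow_right (by norm_num) (Nat.le_succ K)) 1
      rw [← Finset.sum_range_add_sum_Ico _ hK, Finset.sum_range_succ, mul_add]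
      refine add_le_add ih ?_
      calc _ ≤ ∑ n ∈ Finset.Ico (2 ^ K - 1) (2 ^ (K + 1) - 1), a n * ((2 : ℝ) ^ K) ^ (-σ) := by
            refine Finset.sum_le_sum fun n hn => ?_
            refine mul_le_mul_of_nonneg_left ?_ (ha n)
            refine Real.rpow_le_rpow_of_nonpos (by positivity) ?_ (by linarith)
            have h1 := (Finset.mem_Ico.1 hn).1
            have : 2 ^ K ≤ n + 1 := by omega
            exact_mod_cast this
        _ = (∑ n ∈ Finset.Ico (2 ^ K - 1) (2 ^ (K + 1) - 1), a n) * ((2 : ℝ) ^ K) ^ (-σ) := by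
            rw [Finset.sum_mul]
        _ ≤ (∑ n ∈ Finset.range (2 ^ (K + 1)), a n) * ((2 : ℝ) ^ K) ^ (-σ) := by
            refine mul_le_mul_of_nonneg_right ?_ (by positivity)
            refine Finset.sum_le_sum_of_subset_of_nonneg ?_ fun n _ _ => ha n
            intro n hn
            have h1 := (Finset.mem_Ico.1 hn).2
            rw [Finset.mem_range]
            omega
        _ ≤ (((2 ^ (K + 1) : ℕ) : ℝ) ^ t * M) * ((2 : ℝ) ^ K) ^ (-σ) :=
            mul_le_mul_of_nonneg_right (h _) (by positivity)
        _ = 2 ^ t * M * ρ ^ K := by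
            have h2 : ((2 ^ (K + 1) : ℕ) : ℝ) ^ t = 2 ^ t * (2 : ℝ) ^ (K * t) := by
              push_cast
              rw [← Real.rpow_natCast, ← Real.rpow_mul zero_le_two, ← Real.rpow_add two_pos]
              push_cast
              ring_nf
            have h3 : ((2 : ℝ) ^ K) ^ (-σ) = (2 : ℝ) ^ (K * (-σ)) := by
              rw [← Real.rpow_natCast, ← Real.rpow_mul zero_le_two]
            have h4 : ρ ^ K = (2 : ℝ) ^ (K * t) * (2 : ℝ) ^ (K * (-σ)) := by
              rw [← Real.rpow_add two_pos, hρ, ← Real.rpow_mul_natCast zero_le_two]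
              ring_nf
            rw [h2, h3, h4]
            ring
  have hgeom : ∑ k ∈ Finset.range (N + 1), ρ ^ k ≤ (1 - ρ)⁻¹ := by
    rw [← tsum_geometric_of_lt_one hρ0.le hρ1]
    exact (summable_geometric_of_lt_one hρ0.le hρ1).sum_le_tsum _ fun k _ => by positivity
  calc _ ≤ ∑ n ∈ Finset.range (2 ^ (N + 1) - 1), a n * ((n : ℝ) + 1) ^ (-σ) := by
        refine Finset.sum_le_sum_of_subset_of_nonneg ?_ fun n _ _ => hterm n
        refine Finset.range_mono ?_
        have : N + 1 < 2 ^ (N + 1) := Nat.lt_two_pow_self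
        omega
    _ ≤ 2 ^ t * M * ∑ k ∈ Finset.range (N + 1), ρ ^ k := hblock _
    _ ≤ 2 ^ t * M * (1 - ρ)⁻¹ := by gcongr
    _ = _ := by ring

/-! ### Factoring a polynomial into two functions of equal modulus on the circle -/

/-- A square root of `1 - β z`, `|β| ≤ 1`, holomorphic on the disk and continuous up to the
boundary. -/
theorem exists_diffContOnCl_sq_eq_one_sub_mul {β : ℂ} (hβ : ‖β‖ ≤ 1) :
    ∃ k : ℂ → ℂ, DiffContOnCl ℂ k (ball 0 1) ∧ ∀ z, k z ^ 2 = 1 - β * z := by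
  have hle : ∀ z ∈ closedBall (0 : ℂ) 1, ‖β * z‖ ≤ ‖z‖ := fun z _ => by
    rw [norm_mul]
    exact mul_le_of_le_one_left (norm_nonneg _) hβ
  refine ⟨fun z => (1 - β * z) ^ (1 / 2 : ℂ), ⟨?_, ?_⟩, fun z => ?_⟩
  · refine DifferentiableOn.cpow_const (by fun_prop) fun z hz => Or.inl ?_
    have h1 := hle z (ball_subset_closedBall hz)
    have h2 : ‖z‖ < 1 := by simpa using hz
    have h3 := Complex.re_le_norm (β * z)
    rw [Complex.sub_re, Complex.one_re]
    linarith
  · rw [closure_ball _ one_ne_zero]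
    intro z hz
    have h1 := hle z hz
    have h2 : ‖z‖ ≤ 1 := by simpa using hz
    have h3 := Complex.re_le_norm (β * z)
    have h4 : ContinuousAt (fun w : ℂ => w ^ (1 / 2 : ℂ)) (1 - β * z) :=
      Complex.continuousAt_cpow_const_of_re_pos
        (Or.inl (by rw [Complex.sub_re, Complex.one_re]; linarith)) (by norm_num)
    have h5 : ContinuousAt (fun z : ℂ => 1 - β * z) z := by fun_prop
    exact (ContinuousAt.comp (f := fun z : ℂ => 1 - β * z) h4 h5).continuousWithinAt
  · rw [← Complex.cpow_nat_mul]
    simp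

theorem norm_sub_eq_norm_one_sub_conj_mul {z : ℂ} (hz : ‖z‖ = 1) (α : ℂ) :
    ‖z - α‖ = ‖1 - conj α * z‖ := by
  have h : conj z * z = 1 := by rw [Complex.conj_mul', hz]; simp
  calc ‖z - α‖ = ‖conj (z - α)‖ * ‖z‖ := by rw [Complex.norm_conj, hz, mul_one]
    _ = ‖1 - conj α * z‖ := by rw [← norm_mul, map_sub, sub_mul, h]

/-- The factorization for a linear polynomial. A zero inside the disk is put into one of the
factors as a Blaschke factor; any other zero is shared by taking square roots. -/
theorem exists_factor_sub (α : ℂ) :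
    ∃ g h : ℂ → ℂ, DiffContOnCl ℂ g (ball 0 1) ∧ DiffContOnCl ℂ h (ball 0 1) ∧
      (∀ z ∈ closedBall (0 : ℂ) 1, z - α = g z * h z) ∧
      ∀ z, ‖z‖ = 1 → ‖g z‖ ^ 2 = ‖z - α‖ ∧ ‖h z‖ ^ 2 = ‖z - α‖ := by
  rcases lt_or_ge ‖α‖ 1 with hα | hα
  · obtain ⟨k, hk, hk2⟩ := exists_diffContOnCl_sq_eq_one_sub_mul (β := conj α)
      (by rw [Complex.norm_conj]; exact hα.le)
    have hk0 : ∀ z ∈ closedBall (0 : ℂ) 1, k z ≠ 0 := by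
      intro z hz h0
      have h1 := hk2 z
      rw [h0, zero_pow two_ne_zero, eq_comm, sub_eq_zero] at h1
      have h2 : ‖conj α * z‖ < 1 := by
        rw [norm_mul, Complex.norm_conj]
        have : ‖z‖ ≤ 1 := by simpa using hz
        nlinarith [norm_nonneg z, norm_nonneg α]
      rw [← h1, norm_one] at h2
      exact lt_irrefl _ h2
    have hinv : DiffContOnCl ℂ k⁻¹ (ball 0 1) := hk.inv fun z hz => hk0 z (by
      rwa [closure_ball _ one_ne_zero] at hz)
    have hX : DiffContOnCl ℂ (fun z : ℂ => z - α) (ball 0 1) :=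
      Differentiable.diffContOnCl (by fun_prop)
    refine ⟨fun z => k⁻¹ z • (z - α), k, hinv.smul hX, hk, fun z hz => ?_, fun z hz => ?_⟩
    · have := hk0 z hz
      simp only [Pi.inv_apply, smul_eq_mul]
      field_simp
    · have h1 : ‖k z‖ ^ 2 = ‖z - α‖ := by
        rw [← norm_pow, hk2, norm_sub_eq_norm_one_sub_conj_mul hz]
      have h2 : ‖k z‖ ≠ 0 := norm_ne_zero_iff.2 (hk0 z (by simp [hz]))
      refine ⟨?_, h1⟩
      simp only [Pi.inv_apply, smul_eq_mul, norm_mul, norm_inv, ← h1]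
      field_simp
  · have hα0 : α ≠ 0 := by
      rintro rfl
      simp at hα
      linarith
    obtain ⟨k, hk, hk2⟩ := exists_diffContOnCl_sq_eq_one_sub_mul (β := α⁻¹)
      (by rw [norm_inv]; exact inv_le_one_of_one_le₀ hα)
    obtain ⟨c, hc⟩ := IsAlgClosed.exists_pow_nat_eq (-α) two_pos
    have hmul : ∀ z, (c * k z) ^ 2 = z - α := by
      intro z
      rw [mul_pow, hc, hk2]
      field_simp
      ring
    have hd : DiffContOnCl ℂ (fun z => c * k z) (ball 0 1) := hk.const_smul c
    have hn : ∀ z, ‖c * k z‖ ^ 2 = ‖z - α‖ := fun z => by rw [← norm_pow, hmul]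
    exact ⟨_, _, hd, hd, fun z _ => by rw [← sq, hmul], fun z _ => ⟨hn z, hn z⟩⟩

/-- Every polynomial `P` is a product `g h` on the disk, with `|g| ^ 2 = |h| ^ 2 = |P|` on the
circle. -/
theorem Polynomial.exists_factor (P : Polynomial ℂ) :
    ∃ g h : ℂ → ℂ, DiffContOnCl ℂ g (ball 0 1) ∧ DiffContOnCl ℂ h (ball 0 1) ∧
      (∀ z ∈ closedBall (0 : ℂ) 1, P.eval z = g z * h z) ∧
      ∀ z, ‖z‖ = 1 → ‖g z‖ ^ 2 = ‖P.eval z‖ ∧ ‖h z‖ ^ 2 = ‖P.eval z‖ := by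
  rw [(IsAlgClosed.splits P).eq_prod_roots]
  induction P.roots using Multiset.induction_on with
  | empty =>
    obtain ⟨c, hc⟩ := IsAlgClosed.exists_pow_nat_eq P.leadingCoeff two_pos
    refine ⟨fun _ => c, fun _ => c, diffContOnCl_const, diffContOnCl_const, fun z _ => ?_,
      fun z _ => ?_⟩
    · simp [← hc, sq]
    · simp [← hc]
  | cons α s ih =>
    obtain ⟨g, h, hg, hh, hgh, hn⟩ := ih
    obtain ⟨g', h', hg', hh', hgh', hn'⟩ := exists_factor_sub α
    have heval : ∀ z, (Polynomial.C P.leadingCoeff *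
        (Multiset.map (fun a => Polynomial.X - Polynomial.C a) (α ::ₘ s)).prod).eval z =
        (z - α) * (Polynomial.C P.leadingCoeff *
        (Multiset.map (fun a => Polynomial.X - Polynomial.C a) s).prod).eval z := by
      intro z
      simp only [Multiset.map_cons, Multiset.prod_cons, Polynomial.eval_mul, Polynomial.eval_sub,
        Polynomial.eval_X, Polynomial.eval_C]
      ring
    refine ⟨fun z => g' z • g z, fun z => h' z • h z, hg'.smul hg, hh'.smul hh, fun z hz => ?_,
      fun z hz => ?_⟩
    · rw [heval, hgh z hz, hgh' z hz]
      simp only [smul_eq_mul]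
      ring
    · rw [heval]
      simp only [smul_eq_mul, norm_mul, mul_pow, (hn z hz).1, (hn z hz).2, (hn' z hz).1,
        (hn' z hz).2, and_self]

/-! ### Hilbert's inequality -/

theorem sum_range_inv_sqrt_le (N : ℕ) :
    ∑ k ∈ Finset.range N, (√((k : ℝ) + 1))⁻¹ ≤ 2 * √N := by
  induction N with
  | zero => simp
  | succ N ih =>
    rw [Finset.sum_range_succ]
    refine (add_le_add_left ih _).trans ?_
    push_cast
    have h1 : 0 < √((N : ℝ) + 1) := by positivity
    have h2 := Real.sq_sqrt (show (0 : ℝ) ≤ N + 1 by positivity)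
    have h3 := Real.sq_sqrt (show (0 : ℝ) ≤ N by positivity)
    rw [← sub_nonneg]
    have : 2 * √((N : ℝ) + 1) - (2 * √N + (√((N : ℝ) + 1))⁻¹) =
        (√((N : ℝ) + 1) - √N) ^ 2 * (√((N : ℝ) + 1))⁻¹ := by
      field_simp
      linear_combination h2 - h3
    rw [this]
    positivity

/-- Telescoping bound for the tail of `∑ (k + 1) ^ (-3 / 2)`. -/
theorem sum_Ico_inv_mul_sqrt_le {j N : ℕ} (hj : 0 < j) (hjN : j ≤ N) :
    ∑ k ∈ Finset.Ico j N, (((k : ℝ) + 1) * √((k : ℝ) + 1))⁻¹ ≤ 2 * (√j)⁻¹ - 2 * (√N)⁻¹ := by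
  induction N, hjN using Nat.le_induction with
  | base => simp
  | succ N hN ih =>
    rw [Finset.sum_Ico_succ_top hN]
    refine (add_le_add_left ih _).trans ?_
    have hN0 : (0 : ℝ) < N := by exact_mod_cast hj.trans_le hN
    push_cast
    set a := √(N : ℝ) with ha
    set b := √((N : ℝ) + 1) with hb
    have ha0 : 0 < a := Real.sqrt_pos.2 hN0
    have hb0 : 0 < b := Real.sqrt_pos.2 (by linarith)
    have ha2 : a ^ 2 = N := Real.sq_sqrt hN0.le
    have hb2 : b ^ 2 = N + 1 := Real.sq_sqrt (by linarith)
    have hk : ((N : ℝ) + 1) * b = b ^ 3 := by rw [← hb2]; ring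
    have h1 : b ^ 2 - a ^ 2 = 1 := by rw [ha2, hb2]; ring
    have h2 : 2 * a⁻¹ - 2 * b⁻¹ - (b ^ 3)⁻¹ = (b - a) ^ 2 * (2 * b + a) / (a * b ^ 3) := by
      field_simp
      linear_combination a * h1
    have h3 : 0 ≤ (b - a) ^ 2 * (2 * b + a) / (a * b ^ 3) := by positivity
    rw [hk]
    linarith

/-- The Schur test for the Hilbert matrix with the weight `(k + 1) ^ (-1 / 2)`. -/
theorem sum_sqrt_div_hilbert_le (j N : ℕ) :
    ∑ k ∈ Finset.range N, √((j : ℝ) + 1) / √((k : ℝ) + 1) / ((j : ℝ) + k + 1) ≤ 4 := by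
  have hj : 0 < √((j : ℝ) + 1) := by positivity
  have hj2 := Real.sq_sqrt (show (0 : ℝ) ≤ j + 1 by positivity)
  have h0 : ∀ k : ℕ, 0 ≤ √((j : ℝ) + 1) / √((k : ℝ) + 1) / ((j : ℝ) + k + 1) := fun k => by
    positivity
  have hM : N ≤ max N (j + 1) := le_max_left _ _
  refine (Finset.sum_le_sum_of_subset_of_nonneg (Finset.range_mono hM) fun k _ _ => h0 k).trans ?_
  rw [← Finset.sum_range_add_sum_Ico _ (le_max_right N (j + 1))]
  -- For `k ≤ j` the denominator is at least `j + 1`, for `k > j` at least `k + 1`.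
  have h1 : ∑ k ∈ Finset.range (j + 1), √((j : ℝ) + 1) / √((k : ℝ) + 1) / ((j : ℝ) + k + 1) ≤
      2 := by
    calc _ ≤ ∑ k ∈ Finset.range (j + 1), (√((j : ℝ) + 1))⁻¹ * (√((k : ℝ) + 1))⁻¹ := by
          refine Finset.sum_le_sum fun k _ => ?_
          calc _ ≤ √((j : ℝ) + 1) / √((k : ℝ) + 1) / ((j : ℝ) + 1) := by
                gcongr
                linarith [(Nat.cast_nonneg k : (0 : ℝ) ≤ k)]
            _ = _ := by
                rw [div_div, ← hj2]
                field_simp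
                rw [Real.sqrt_sq hj.le]
      _ ≤ (√((j : ℝ) + 1))⁻¹ * (2 * √((j : ℝ) + 1)) := by
          rw [← Finset.mul_sum]
          have := sum_range_inv_sqrt_le (j + 1)
          push_cast at this
          gcongr
      _ = 2 := by field_simp
  have h2 : ∑ k ∈ Finset.Ico (j + 1) (max N (j + 1)),
      √((j : ℝ) + 1) / √((k : ℝ) + 1) / ((j : ℝ) + k + 1) ≤ 2 := by
    calc _ ≤ ∑ k ∈ Finset.Ico (j + 1) (max N (j + 1)),
          √((j : ℝ) + 1) * (((k : ℝ) + 1) * √((k : ℝ) + 1))⁻¹ := by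
          refine Finset.sum_le_sum fun k _ => ?_
          calc _ ≤ √((j : ℝ) + 1) / √((k : ℝ) + 1) / ((k : ℝ) + 1) := by
                gcongr
                linarith [(Nat.cast_nonneg j : (0 : ℝ) ≤ j)]
            _ = _ := by
                rw [div_div, div_eq_mul_inv, mul_comm √((k : ℝ) + 1)]
      _ ≤ √((j : ℝ) + 1) * (2 * (√((j : ℝ) + 1))⁻¹) := by
          rw [← Finset.mul_sum]
          have := sum_Ico_inv_mul_sqrt_le (Nat.succ_pos j) (le_max_right N (j + 1))
          have h3 : 0 ≤ (√((max N (j + 1) : ℕ) : ℝ))⁻¹ := by positivity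
          refine mul_le_mul_of_nonneg_left (this.trans ?_) hj.le
          push_cast at h3 ⊢
          linarith
      _ = 2 := by field_simp
  linarith

/-- Hilbert's inequality, with a non-optimal constant. -/
theorem sum_mul_div_hilbert_le (x y : ℕ → ℝ) (N : ℕ) :
    ∑ j ∈ Finset.range N, ∑ k ∈ Finset.range N, x j * y k / ((j : ℝ) + k + 1) ≤
      2 * ∑ j ∈ Finset.range N, x j ^ 2 + 2 * ∑ k ∈ Finset.range N, y k ^ 2 := by
  set w : ℕ → ℕ → ℝ := fun j k => √((j : ℝ) + 1) / √((k : ℝ) + 1) / ((j : ℝ) + k + 1) with hw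
  -- The arithmetic-geometric mean inequality for `x j * a` and `y k * b` below.
  have hpt : ∀ j k : ℕ, x j * y k / ((j : ℝ) + k + 1) ≤
      1 / 2 * (x j ^ 2 * w j k) + 1 / 2 * (y k ^ 2 * w k j) := by
    intro j k
    set a := √((j : ℝ) + 1) with ha
    set b := √((k : ℝ) + 1) with hb
    have ha0 : 0 < a := by positivity
    have hb0 : 0 < b := by positivity
    have hjk : (0 : ℝ) < (j : ℝ) + k + 1 := by positivity
    have : 1 / 2 * (x j ^ 2 * w j k) + 1 / 2 * (y k ^ 2 * w k j) - x j * y k / ((j : ℝ) + k + 1) =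
        (x j * a - y k * b) ^ 2 / (2 * a * b * ((j : ℝ) + k + 1)) := by
      simp only [hw, ← ha, ← hb, add_comm (k : ℝ) (j : ℝ)]
      field_simp
      ring
    rw [← sub_nonneg, this]
    positivity
  calc _ ≤ ∑ j ∈ Finset.range N, ∑ k ∈ Finset.range N,
        (1 / 2 * (x j ^ 2 * w j k) + 1 / 2 * (y k ^ 2 * w k j)) :=
        Finset.sum_le_sum fun j _ => Finset.sum_le_sum fun k _ => hpt j k
    _ = 1 / 2 * ∑ j ∈ Finset.range N, x j ^ 2 * ∑ k ∈ Finset.range N, w j k +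
        1 / 2 * ∑ k ∈ Finset.range N, y k ^ 2 * ∑ j ∈ Finset.range N, w k j := by
        simp only [Finset.sum_add_distrib, Finset.mul_sum]
        congr 1
        exact Finset.sum_comm
    _ ≤ 1 / 2 * ∑ j ∈ Finset.range N, x j ^ 2 * 4 +
        1 / 2 * ∑ k ∈ Finset.range N, y k ^ 2 * 4 := by
        gcongr
        · exact sum_sqrt_div_hilbert_le _ _
        · exact sum_sqrt_div_hilbert_le _ _
    _ = _ := by
        rw [← Finset.sum_mul, ← Finset.sum_mul]
        ring

/-! ### Hardy's inequality for polynomials -/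

theorem taylorCoeffZero_mul {g h : ℂ → ℂ} (hg : DifferentiableOn ℂ g (ball 0 1))
    (hh : DifferentiableOn ℂ h (ball 0 1)) (n : ℕ) :
    taylorCoeffZero (g * h) n =
      ∑ i ∈ Finset.range (n + 1), taylorCoeffZero g i * taylorCoeffZero h (n - i) := by
  have h0 : ball (0 : ℂ) 1 ∈ nhds 0 := ball_mem_nhds _ one_pos
  rw [taylorCoeffZero, iteratedDeriv_mul (hg.analyticAt h0).contDiffAt
    (hh.analyticAt h0).contDiffAt, Finset.sum_div]
  refine Finset.sum_congr rfl fun i hi => ?_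
  have hi' : i ≤ n := Nat.lt_succ_iff.1 (Finset.mem_range.1 hi)
  have h1 : (n.choose i : ℂ) * i.factorial * (n - i).factorial = n.factorial := by
    exact_mod_cast Nat.choose_mul_factorial_mul_factorial hi'
  have h2 : (n.factorial : ℂ) ≠ 0 := by exact_mod_cast n.factorial_ne_zero
  have h3 : (i.factorial : ℂ) ≠ 0 := by exact_mod_cast i.factorial_ne_zero
  have h4 : ((n - i).factorial : ℂ) ≠ 0 := by exact_mod_cast (n - i).factorial_ne_zero
  rw [taylorCoeffZero, taylorCoeffZero]
  field_simp
  rw [← h1]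
  ring

/-- Hardy's inequality. Since the factors have the same modulus on the circle, Bessel's inequality
bounds the square sums of their coefficients by the mean of `|P|`. -/
theorem Polynomial.sum_norm_taylorCoeffZero_div_le (P : Polynomial ℂ) (N : ℕ) :
    ∑ n ∈ Finset.range N, ‖taylorCoeffZero (fun z => P.eval z) n‖ / ((n : ℝ) + 1) ≤
      4 * ∫ θ, ‖P.eval (circleMap 0 1 θ)‖ ∂circleProb := by
  obtain ⟨g, h, hg, hh, hgh, hn⟩ := P.exists_factor
  have hcoeff : ∀ n, taylorCoeffZero (fun z => P.eval z) n =
      ∑ i ∈ Finset.range (n + 1), taylorCoeffZero g i * taylorCoeffZero h (n - i) := by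
    intro n
    rw [← taylorCoeffZero_mul hg.differentiableOn hh.differentiableOn, taylorCoeffZero,
      taylorCoeffZero, Filter.EventuallyEq.iteratedDeriv_eq]
    filter_upwards [closedBall_mem_nhds (0 : ℂ) one_pos] with z hz using hgh z hz
  set x : ℕ → ℝ := fun n => ‖taylorCoeffZero g n‖ with hx
  set y : ℕ → ℝ := fun n => ‖taylorCoeffZero h n‖ with hy
  have hbound : ∀ n, ‖taylorCoeffZero (fun z => P.eval z) n‖ / ((n : ℝ) + 1) ≤
      ∑ i ∈ Finset.range (n + 1), x i * y (n - i) / ((n : ℝ) + 1) := by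
    intro n
    rw [hcoeff, ← Finset.sum_div]
    gcongr
    refine (norm_sum_le _ _).trans_eq ?_
    simp [hx, hy]
  have hcirc : ∀ θ, ‖circleMap 0 1 θ‖ = 1 := fun θ => by simp
  have hgi : ∑ j ∈ Finset.range N, x j ^ 2 ≤ ∫ θ, ‖P.eval (circleMap 0 1 θ)‖ ∂circleProb := by
    simpa only [(hn _ (hcirc _)).1] using hg.sum_norm_sq_taylorCoeffZero_le N
  have hhi : ∑ j ∈ Finset.range N, y j ^ 2 ≤ ∫ θ, ‖P.eval (circleMap 0 1 θ)‖ ∂circleProb := by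
    simpa only [(hn _ (hcirc _)).2] using hh.sum_norm_sq_taylorCoeffZero_le N
  calc _ ≤ ∑ n ∈ Finset.range N, ∑ i ∈ Finset.range (n + 1), x i * y (n - i) / ((n : ℝ) + 1) :=
        Finset.sum_le_sum fun n _ => hbound n
    _ = ∑ n ∈ Finset.range N, ∑ i ∈ Finset.range (n + 1),
          x i * y (n - i) / ((i : ℝ) + (n - i : ℕ) + 1) := by
        refine Finset.sum_congr rfl fun n _ => Finset.sum_congr rfl fun i hi => ?_
        rw [Nat.cast_sub (Nat.lt_succ_iff.1 (Finset.mem_range.1 hi))]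
        ring_nf
    _ = ∑ j ∈ Finset.range N, ∑ k ∈ Finset.range (N - j), x j * y k / ((j : ℝ) + k + 1) :=
        Finset.sum_range_diag_flip N fun j k => x j * y k / ((j : ℝ) + k + 1)
    _ ≤ ∑ j ∈ Finset.range N, ∑ k ∈ Finset.range N, x j * y k / ((j : ℝ) + k + 1) := by
        refine Finset.sum_le_sum fun j _ => ?_
        refine Finset.sum_le_sum_of_subset_of_nonneg (Finset.range_mono (Nat.sub_le N j))
          fun k _ _ => ?_
        positivity
    _ ≤ _ := by
        have := sum_mul_div_hilbert_le x y N
        linarith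

/-! ### From polynomials to the Hardy space -/

theorem taylorCoeffZero_hasSum {f : ℂ → ℂ} (hf : DifferentiableOn ℂ f (ball 0 1)) {z : ℂ}
    (hz : z ∈ ball (0 : ℂ) 1) : HasSum (fun n => taylorCoeffZero f n * z ^ n) (f z) := by
  have h := Complex.hasSum_taylorSeries_on_ball hf hz
  refine h.congr_fun fun n => ?_
  simp only [sub_zero, smul_eq_mul, taylorCoeffZero]
  ring

theorem integral_circle_le_hardyMean {p : ℝ} (hp : 0 < p) {f : ℂ → ℂ}
    (hf : DifferentiableOn ℂ f (ball 0 1)) (hfm : hardyMean p f < ∞) {r : ℝ}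
    (hr : r ∈ Set.Ioo (0 : ℝ) 1) :
    ∫ θ, ‖f (r * circleMap 0 1 θ)‖ ^ p ∂circleProb ≤ (hardyMean p f).toReal := by
  have hc : Continuous fun θ : ℝ => f (r * circleMap 0 1 θ) := by
    refine hf.continuousOn.comp_continuous
      (continuous_const.mul (_root_.continuous_circleMap 0 1)) fun θ => ?_
    simpa [abs_of_pos hr.1] using hr.2
  have hm : Measurable fun θ : ℝ => ‖f (r * circleMap 0 1 θ)‖ₑ ^ p :=
    hc.measurable.enorm.pow_const p
  have h1 : ∀ θ, ‖f (r * circleMap 0 1 θ)‖ ^ p = (‖f (r * circleMap 0 1 θ)‖ₑ ^ p).toReal := by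
    intro θ
    rw [← ENNReal.toReal_rpow, toReal_enorm]
  simp_rw [h1]
  rw [integral_toReal hm.aemeasurable
    (ae_of_all _ fun θ => ENNReal.rpow_lt_top_of_nonneg hp.le enorm_ne_top)]
  refine ENNReal.toReal_mono hfm.ne ?_
  rw [circleProb, lintegral_smul_measure, smul_eq_mul]
  simp only [circleMap, zero_add, Complex.ofReal_one, one_mul]
  exact le_iSup₂ (f := fun (r : ℝ) (_ : r ∈ Set.Ioo (0 : ℝ) 1) =>
      ENNReal.ofReal (1 / (2 * Real.pi)) * ∫⁻ θ in Set.Ioc (0 : ℝ) (2 * Real.pi),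
      ‖f ((r : ℂ) * Complex.exp ((θ : ℂ) * Complex.I))‖ₑ ^ p) r hr

/-- A bound on finitely many coefficients passes from polynomials to `H^p`: apply it to the Taylor
polynomials of `z ↦ f (r z)`, let the degree tend to infinity, then `r` to `1`. -/
theorem sum_mul_norm_taylorCoeffZero_le_hardyNorm {p : ℝ} (hp : 0 < p) (w : ℕ → ℝ) (N : ℕ) {K : ℝ}
    (hK : 0 ≤ K)
    (h : ∀ P : Polynomial ℂ, ∑ n ∈ Finset.range N, ‖taylorCoeffZero (fun z => P.eval z) n‖ * w n ≤
      K * (∫ θ, ‖P.eval (circleMap 0 1 θ)‖ ^ p ∂circleProb) ^ (1 / p))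
    {f : ℂ → ℂ} (hf : f ∈ hardySpace p hp) :
    ∑ n ∈ Finset.range N, ‖taylorCoeffZero f n‖ * w n ≤ K * hardyNorm p f := by
  obtain ⟨hfd, -, hfm⟩ := hf
  -- The bound for the dilation, whose coefficients are `a_n r ^ n`.
  have hdil : ∀ r ∈ Set.Ioo (0 : ℝ) 1,
      ∑ n ∈ Finset.range N, ‖taylorCoeffZero f n * (r : ℂ) ^ n‖ * w n ≤ K * hardyNorm p f := by
    intro r hr
    have hrball : (r : ℂ) ∈ ball (0 : ℂ) 1 := by simpa [abs_of_pos hr.1] using hr.2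
    set a : ℕ → ℂ := fun n => taylorCoeffZero f n * (r : ℂ) ^ n with ha
    have hsummable : Summable fun n => ‖a n‖ := (taylorCoeffZero_hasSum hfd hrball).summable.norm
    set P : ℕ → Polynomial ℂ := fun M =>
      ∑ n ∈ Finset.range M, Polynomial.C (a n) * Polynomial.X ^ n with hP
    have heval : ∀ M z, (P M).eval z = ∑ n ∈ Finset.range M, a n * z ^ n := by
      intro M z
      simp [hP, Polynomial.eval_finsetSum]
    have hlim : Tendsto (fun M => ∫ θ, ‖(P M).eval (circleMap 0 1 θ)‖ ^ p ∂circleProb) atTop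
        (𝓝 (∫ θ, ‖f (r * circleMap 0 1 θ)‖ ^ p ∂circleProb)) := by
      refine tendsto_integral_of_dominated_convergence (fun _ => (∑' n, ‖a n‖) ^ p)
        (fun M => ?_) (integrable_const _) (fun M => ae_of_all _ fun θ => ?_)
        (ae_of_all _ fun θ => ?_)
      · exact ((((P M).continuous.comp (_root_.continuous_circleMap 0 1)).norm).rpow_const
          fun _ => Or.inr hp.le).aestronglyMeasurable
      · rw [Real.norm_of_nonneg (by positivity), heval]
        refine Real.rpow_le_rpow (norm_nonneg _) ?_ hp.le
        refine (norm_sum_le _ _).trans ?_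
        simpa using hsummable.sum_le_tsum (Finset.range M) fun n _ => norm_nonneg _
      · have hz : (r : ℂ) * circleMap 0 1 θ ∈ ball (0 : ℂ) 1 := by
          simpa [abs_of_pos hr.1] using hr.2
        have h1 := (taylorCoeffZero_hasSum hfd hz).tendsto_sum_nat
        refine (h1.congr fun M => ?_).norm.rpow_const (Or.inr hp.le)
        rw [heval]
        refine Finset.sum_congr rfl fun n _ => ?_
        rw [mul_pow, ha, mul_assoc]
    have hle : ∑ n ∈ Finset.range N, ‖a n‖ * w n ≤
        K * (∫ θ, ‖f (r * circleMap 0 1 θ)‖ ^ p ∂circleProb) ^ (1 / p) := by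
      refine ge_of_tendsto ((hlim.rpow_const (Or.inr (by positivity))).const_mul K) ?_
      filter_upwards [eventually_ge_atTop N] with M hM
      refine le_trans (le_of_eq ?_) (h (P M))
      refine Finset.sum_congr rfl fun n hn => ?_
      simp_rw [heval]
      rw [taylorCoeffZero_sum_pow, if_pos ((Finset.mem_range.1 hn).trans_le hM)]
    refine hle.trans (mul_le_mul_of_nonneg_left ?_ hK)
    exact Real.rpow_le_rpow (integral_nonneg fun θ => by positivity)
      (integral_circle_le_hardyMean hp hfd hfm hr) (by positivity)
  have hcont : Tendsto (fun r : ℝ => ∑ n ∈ Finset.range N,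
      ‖taylorCoeffZero f n * (r : ℂ) ^ n‖ * w n) (𝓝[<] 1)
      (𝓝 (∑ n ∈ Finset.range N, ‖taylorCoeffZero f n * ((1 : ℝ) : ℂ) ^ n‖ * w n)) := by
    refine (Continuous.tendsto ?_ 1).mono_left nhdsWithin_le_nhds
    fun_prop
  have hfin := le_of_tendsto hcont (by
    filter_upwards [Ioo_mem_nhdsLT (zero_lt_one' ℝ)] with r hr using hdil r hr)
  simpa using hfin

theorem Polynomial.diffContOnCl_eval (P : Polynomial ℂ) :
    DiffContOnCl ℂ (fun z => P.eval z) (ball 0 1) :=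
  P.differentiable.diffContOnCl

/-! ### The values `f_n(s)` and the functional -/

/-- By the mean value inequality, `f_n(s) = O((n + 1) ^ (-Re s))`. -/
theorem exists_norm_lambdaValue_le {s : ℂ} (hs : 0 < s.re) :
    ∃ B : ℝ, 0 ≤ B ∧ ∀ n : ℕ, ‖lambdaValue n s‖ ≤ B * ((n : ℝ) + 1) ^ (-s.re) := by
  refine ⟨‖s‖⁻¹ + ‖s‖⁻¹ * ‖1 - s‖ * 2 ^ s.re, by positivity, fun n => ?_⟩
  rcases Nat.eq_zero_or_pos n with rfl | hn
  · simp only [lambdaValue, if_true, one_div, norm_neg, norm_inv,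
      Nat.cast_zero, zero_add, Real.one_rpow, mul_one]
    exact le_add_of_nonneg_right (a := ‖s‖⁻¹) (by positivity)
  have hn0 : (0 : ℝ) < n := by exact_mod_cast hn
  have hn1 : (1 : ℝ) ≤ n := by exact_mod_cast hn
  have hmv : ‖(((n + 1 : ℝ) : ℂ)) ^ (1 - s) - ((n : ℝ) : ℂ) ^ (1 - s)‖ ≤
      ‖1 - s‖ * (n : ℝ) ^ (-s.re) * ((n + 1 : ℝ) - n) := by
    refine norm_image_sub_le_of_norm_deriv_le_segment' (a := (n : ℝ)) (b := (n : ℝ) + 1)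
      (f := fun x : ℝ => (x : ℂ) ^ (1 - s)) (f' := fun x : ℝ => (1 - s) * (x : ℂ) ^ (1 - s - 1))
      (fun x hx => ?_) (fun x hx => ?_) _ (Set.right_mem_Icc.2 (by linarith))
    · have hx0 : 0 < x := hn0.trans_le hx.1
      exact ((Complex.hasStrictDerivAt_cpow_const (Or.inl (by simpa using hx0))).hasDerivAt.comp_ofReal
        ).hasDerivWithinAt
    · have hx0 : 0 < x := hn0.trans_le hx.1
      rw [norm_mul, Complex.norm_cpow_eq_rpow_re_of_pos hx0]
      refine mul_le_mul_of_nonneg_left ?_ (norm_nonneg _)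
      have : (1 - s - 1).re = -s.re := by simp
      rw [this]
      exact Real.rpow_le_rpow_of_nonpos hn0 hx.1 (by linarith)
  -- Since `n ≥ (n + 1) / 2`.
  have hcmp : (n : ℝ) ^ (-s.re) ≤ 2 ^ s.re * ((n : ℝ) + 1) ^ (-s.re) := by
    have : (2 : ℝ) ^ s.re * ((n : ℝ) + 1) ^ (-s.re) = (((n : ℝ) + 1) / 2) ^ (-s.re) := by
      rw [Real.div_rpow (by positivity) zero_le_two, Real.rpow_neg zero_le_two, div_inv_eq_mul,
        mul_comm]
    rw [this]
    exact Real.rpow_le_rpow_of_nonpos (by positivity) (by linarith) (by linarith)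
  rw [lambdaValue, if_neg hn.ne', norm_mul, norm_neg, norm_div, norm_one, one_div]
  push_cast at hmv
  calc _ ≤ ‖s‖⁻¹ * (‖1 - s‖ * (2 ^ s.re * ((n : ℝ) + 1) ^ (-s.re))) := by
        refine mul_le_mul_of_nonneg_left (hmv.trans ?_) (by positivity)
        rw [add_sub_cancel_left, mul_one]
        exact mul_le_mul_of_nonneg_left hcmp (norm_nonneg _)
    _ = ‖s‖⁻¹ * ‖1 - s‖ * 2 ^ s.re * ((n : ℝ) + 1) ^ (-s.re) := by ring
    _ ≤ _ := by
        refine mul_le_mul_of_nonneg_right ?_ (by positivity)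
        exact le_add_of_nonneg_left (by positivity)

theorem taylorCoeffZero_hardyMonomial {p : ℝ} (hp : 0 < p) (m n : ℕ) :
    taylorCoeffZero (hardyMonomial p hp m : ℂ → ℂ) n = if n = m then 1 else 0 := by
  have h : (hardyMonomial p hp m : ℂ → ℂ) =ᶠ[𝓝 0] fun z => z ^ m := by
    filter_upwards [ball_mem_nhds (0 : ℂ) one_pos] with z hz
    exact Set.indicator_of_mem hz _
  rw [taylorCoeffZero, h.iteratedDeriv_eq, iteratedDeriv_fun_pow_zero]
  split_ifs with hnm
  · subst hnm
    exact div_self (by exact_mod_cast n.factorial_ne_zero)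
  · simp

/-- A coefficient bound with weights `(n + 1) ^ (-Re s)` makes `Λ^(s)` well defined and
bounded. -/
theorem lambdaBoundedOn_of_sum_le {p : ℝ} (hp : 0 < p) {s : ℂ} (hs : 0 < s.re) (C : ℝ)
    (h : ∀ f ∈ hardySpace p hp, ∀ N : ℕ, ∑ n ∈ Finset.range N,
      ‖taylorCoeffZero f n‖ * ((n : ℝ) + 1) ^ (-s.re) ≤ C * hardyNorm p f) :
    LambdaBoundedOn p hp s := by
  obtain ⟨B, hB0, hB⟩ := exists_norm_lambdaValue_le hs
  have hpartial : ∀ f ∈ hardySpace p hp, ∀ N : ℕ,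
      ∑ n ∈ Finset.range N, ‖taylorCoeffZero f n * lambdaValue n s‖ ≤
        B * (C * hardyNorm p f) := by
    intro f hf N
    calc _ ≤ ∑ n ∈ Finset.range N,
          B * (‖taylorCoeffZero f n‖ * ((n : ℝ) + 1) ^ (-s.re)) := by
          refine Finset.sum_le_sum fun n _ => ?_
          rw [norm_mul]
          calc _ ≤ ‖taylorCoeffZero f n‖ * (B * ((n : ℝ) + 1) ^ (-s.re)) :=
                mul_le_mul_of_nonneg_left (hB n) (norm_nonneg _)
            _ = _ := by ring
      _ ≤ _ := by
          rw [← Finset.mul_sum]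
          exact mul_le_mul_of_nonneg_left (h f hf N) hB0
  have hsn : ∀ f ∈ hardySpace p hp,
      Summable fun n => ‖taylorCoeffZero f n * lambdaValue n s‖ := fun f hf =>
    summable_of_sum_range_le (fun n => norm_nonneg _) (hpartial f hf)
  have hsum : ∀ f ∈ hardySpace p hp,
      Summable fun n => taylorCoeffZero f n * lambdaValue n s := fun f hf => (hsn f hf).of_norm
  have hcd : ∀ f ∈ hardySpace p hp, ∀ n : ℕ, ContDiffAt ℂ n f 0 := fun f hf n =>
    (hf.1.analyticAt (ball_mem_nhds _ one_pos)).contDiffAt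
  refine ⟨
    { toFun := fun f => ∑' n, taylorCoeffZero (f : ℂ → ℂ) n * lambdaValue n s
      map_add' := fun f g => ?_
      map_smul' := fun c f => ?_ }, fun m => ?_, fun f => (hsum f f.2).hasSum,
      B * C, fun f => ?_⟩
  · rw [← (hsum f f.2).tsum_add (hsum g g.2)]
    refine tsum_congr fun n => ?_
    rw [Submodule.coe_add, taylorCoeffZero, iteratedDeriv_add (hcd f f.2 n) (hcd g g.2 n)]
    simp only [taylorCoeffZero]
    ring
  · rw [RingHom.id_apply, smul_eq_mul, ← tsum_mul_left]
    refine tsum_congr fun n => ?_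
    rw [Submodule.coe_smul, taylorCoeffZero, iteratedDeriv_const_smul_field]
    simp only [taylorCoeffZero, smul_eq_mul]
    ring
  · simp only [LinearMap.coe_mk, AddHom.coe_mk, taylorCoeffZero_hardyMonomial]
    rw [tsum_eq_single m fun n hn => by simp [hn]]
    simp
  · simp only [LinearMap.coe_mk, AddHom.coe_mk]
    refine (norm_tsum_le_tsum_norm (hsn f f.2)).trans ?_
    rw [mul_assoc]
    exact Real.tsum_le_of_sum_range_le (fun n => norm_nonneg _) (hpartial f f.2)

/-! ### Boundedness of the functional -/

theorem lambdaBoundedOn_one {s : ℂ} (hs : 1 ≤ s.re) : LambdaBoundedOn 1 zero_lt_one s := by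
  refine lambdaBoundedOn_of_sum_le zero_lt_one (by linarith) 4 fun f hf N => ?_
  refine sum_mul_norm_taylorCoeffZero_le_hardyNorm zero_lt_one _ N (by norm_num) (fun P => ?_) hf
  simp only [Real.rpow_one, div_one]
  refine le_trans (Finset.sum_le_sum fun n _ => ?_) (P.sum_norm_taylorCoeffZero_div_le N)
  rw [div_eq_mul_inv, ← Real.rpow_neg_one]
  refine mul_le_mul_of_nonneg_left ?_ (norm_nonneg _)
  exact Real.rpow_le_rpow_of_exponent_le
    (by linarith [(Nat.cast_nonneg n : (0 : ℝ) ≤ n)]) (by linarith)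

theorem lambdaBoundedOn_of_one_lt {p : ℝ} (hp0 : 0 < p) (hp1 : 1 < p) (hp2 : p ≤ 2) {s : ℂ}
    (hs : 1 / p < s.re) : LambdaBoundedOn p hp0 s := by
  have hp' : 0 < 1 / p := by positivity
  obtain ⟨C, hC⟩ := exists_sum_rpow_neg_le hs hp'.le
  refine lambdaBoundedOn_of_sum_le hp0 (hp'.trans hs) C fun f hf => ?_
  refine hC _ _ (fun n => norm_nonneg _) (Real.rpow_nonneg ENNReal.toReal_nonneg _) fun N => ?_
  have := sum_mul_norm_taylorCoeffZero_le_hardyNorm hp0 (fun _ => 1) N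
    (K := (N : ℝ) ^ (1 / p)) (by positivity) (fun P => by
      simpa using P.diffContOnCl_eval.sum_norm_taylorCoeffZero_le hp1 hp2 N) hf
  simpa using this

theorem mainTheorem5 :
    (∀ (p : ℝ) (hp1 : 1 ≤ p), p ≤ 2 → ∀ s : ℂ, 1 / p < s.re →
      LambdaBoundedOn p (zero_lt_one.trans_le hp1) s) ∧
    (∀ s : ℂ, 1 ≤ s.re → LambdaBoundedOn 1 zero_lt_one s) := by
  refine ⟨fun p hp1 hp2 s hs => ?_, fun s hs => lambdaBoundedOn_one hs⟩
  rcases hp1.eq_or_lt with rfl | h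
  · exact lambdaBoundedOn_one (by rw [div_one] at hs; exact hs.le)
  · exact lambdaBoundedOn_of_one_lt _ h hp2 hs
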